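/- **Setting.** Let $r\ge 0$, $n_1,\dots,n_r\ge 1$, $n=n_1+\dots+n_r$, and let $M\subset\mathbb R^{2n}$ be an open set with coordinates $(\lambda,\mu)=(\lambda^1,\dots,\lambda^n,\mu_1,\dots,\mu_n)$. Let $\varphi_j^k$, $\psi_j$ ($1\le j\le n$, $1\le k\le r$) be functions of two variables, smooth at all points $(\lambda^j,\mu_j)$ with $(\lambda,\mu)\in M$. Consider the Stäckel separation relations $$\sum_{k=1}^r\varphi_j^k(\lambda^j,\mu_j)\,h^{(k)}(\lambda^j)=\psi_j(\lambda^j,\mu_j),\quad j=1,\dots,n,\qquad h^{(k)}(x)=\sum_{i=1}^{n_k}x^{n_k-i}h_i^{(k)},$$ a linear system for the $n$ unknowns $h_i^{(k)}$ whose determinant is assumed to be nonzero on $M$. Let $h_i^{(k)}$ be its solution, and for $1\le l\le r$ let $F_i^{(k,l)}$ be the solution of the linear system $$\sum_{k=1}^r\varphi_j^k(\lambda^j,\mu_j)\sum_{i=1}^{n_k}(\lambda^j)^{n_k-i}F_i^{(k,l)}=\varphi_j^l(\lambda^j,\mu_j)(\lambda^j)^{n_l},\quad j=1,\dots,n .$$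 On $M$ put $\pi_0=\sum_i\partial_{\lambda^i}\wedge\partial_{\mu_i}$, $\pi_1=\sum_i\lambda^i\partial_{\lambda^i}\wedge\partial_{\mu_i}$, $\omega_0=-\sum_i d\lambda^i\wedge d\mu_i$, $\omega_1=-\sum_i\lambda^i d\lambda^i\wedge d\mu_i$ and $x_i^{(k)}=\pi_0\,dh_i^{(k)}$. Let $\mathcal M=M\times\mathbb R^r$, with additional coordinates $c_1,\dots,c_r$, and let $\Pi_0,\Pi_{1D},\Omega_0,\Omega_{1D},X_i^{(k)}$ be the trivial lifts of $\pi_0,\pi_1,\omega_0,\omega_1,x_i^{(k)}$ to $\mathcal M$ (independent of $c$, no components along $c$). Tensors act as operators by $(\Omega X)_i=\sum_j\Omega_{ij}X^j$ and $(\Pi\alpha)^i=\sum_j\Pi^{ij}\alpha_j$. On $\mathcal M$ put $$\Omega_1=\Omega_{1D}+\sum_{k=1}^r dh_1^{(k)}\wedge dc_k,\qquad Y_0^{(k)}=\frac{\partial}{\partial c_k},\qquad Y_i^{(k)}=X_i^{(k)}-\sum_{l=1}^rF_i^{(k,l)}Y_0^{(l)}\quad(1\le i\le n_k).$$ A *presymplectic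 form* is a smooth closed two-form; a *Poisson tensor* is a smooth bivector with vanishing Schouten bracket (both possibly degenerate). A Poisson tensor $\Pi$ and a presymplectic form $\Omega$ are a *dual pair* of co-rank $r$, realized by functions $c_1,\dots,c_r$ and linearly independent vector fields $Z_1,\dots,Z_r$, if $\ker\Pi=\mathrm{Sp}\{dc_i\}$, $\ker\Omega=\mathrm{Sp}\{Z_i\}$, $Z_i(c_j)=\delta_{ij}$, $I=\Pi\Omega+\sum_iZ_i\otimes dc_i$ and $I=\Omega\Pi+\sum_idc_i\otimes Z_i$. Closed two-forms $\Omega_0,\Omega_1$ are *d-compatible with respect to* a Poisson tensor $\Pi_0$ if $\Pi_0$ is dual to $\Omega_0$ and $\Pi_0\Omega_1\Pi_0$ is Poisson. **Theorem.** (a) The functions $h_i^{(k)}$ and $F_i^{(k,l)}$ are smooth on $M$, and they are the unique solutions of their linear systems. (b) $(\Pi_0,\Omega_0)$ is a dual pair of co-rank $r$ on $\mathcal M$, realized by $c_1,\dots,c_r$ and $Y_0^{(1)},\dots,Y_0^{(r)}$. At points where all $\lambda^i\ne0$, $\ker\Omega_{1D}=\ker\Omega_0$ and $\ker\Pi_{1D}=\ker\Pi_0$.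 (c) $\Omega_1$ is a presymplectic form, the $Y_i^{(k)}$ are smooth vector fields on $\mathcal M$, and for $k=1,\dots,r$ they form a bi-inverse-Hamiltonian chain $$\Omega_0Y_0^{(k)}=0,\qquad \Omega_0Y_{i+1}^{(k)}=dh_{i+1}^{(k)}=\Omega_1Y_i^{(k)}\quad(0\le i<n_k),\qquad \Omega_1Y_{n_k}^{(k)}=0,$$ so that each chain runs from a kernel field of $\Omega_0$ to a kernel field of $\Omega_1$. (d) $\Pi_0\Omega_1\Pi_0=\Pi_{1D}$, and $\Omega_0$ and $\Omega_1$ are d-compatible with respect to $\Pi_0$. -/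

import Mathlib

open scoped ContDiff Matrix

noncomputable section

/-! ### Tensor calculus on `ℝ^K`, `K` a finite set of coordinates

A covector or a vector is given by its components, a two-form or a bivector by its component matrix,
so that `Ω = ½ ∑ Ω i j dx^i ∧ dx^j` and `Π = ½ ∑ Π i j ∂_i ∧ ∂_j`. As operators they act by
`(Ω X)_i = ∑ j, Ω i j X^j` and `(Π α)^i = ∑ j, Π i j α_j`, which is `Matrix.mulVec`. -/

namespace Presymplectic

variable {K : Type} [Fintype K] [DecidableEq K]

/-- Components `∂_j f` of the differential `df` at `z`. -/
def differential (f : (K → ℝ) → ℝ) (z : K → ℝ) : K → ℝ :=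
  fun j => fderiv ℝ f z (Pi.single j 1)

/-- `a ∧ b = a ⊗ b - b ⊗ a`, for two covectors or two vectors given by components. -/
def wedge (a b : K → ℝ) : Matrix K K ℝ :=
  Matrix.vecMulVec a b - Matrix.vecMulVec b a

/-- The basic two-form `dx^i ∧ dx^j` as an alternating map, `(v, w) ↦ v^i w^j - v^j w^i`. -/
def basicTwoForm (i j : K) : (K → ℝ) [⋀^Fin 2]→L[ℝ] ℝ :=
  ContinuousAlternatingMap.alternatizeUncurryFin
    ((ContinuousLinearMap.proj (R := ℝ) (φ := fun _ : K => ℝ) i).smulRight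
      (ContinuousAlternatingMap.ofSubsingleton ℝ (K → ℝ) ℝ (0 : Fin 1)
        (ContinuousLinearMap.proj (R := ℝ) (φ := fun _ : K => ℝ) j)))

/-- The alternating form `½ ∑ A i j dx^i ∧ dx^j` with component matrix `A`. -/
def twoForm (A : Matrix K K ℝ) : (K → ℝ) [⋀^Fin 2]→L[ℝ] ℝ :=
  (1 / 2 : ℝ) • ∑ i, ∑ j, A i j • basicTwoForm i j

/-- A field of matrices is a smooth field of skew-symmetric tensors on `D`. -/
structure IsSmoothSkewOn (D : Set (K → ℝ)) (A : (K → ℝ) → Matrix K K ℝ) : Prop where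
  smooth : ∀ i j, ContDiffOn ℝ ∞ (fun z => A z i j) D
  skew : ∀ z ∈ D, (A z)ᵀ = -A z

/-- Presymplectic form on `D`: a smooth closed two-form, possibly degenerate. -/
structure IsPresymplecticOn (D : Set (K → ℝ)) (Om : (K → ℝ) → Matrix K K ℝ) : Prop
    extends IsSmoothSkewOn D Om where
  closed : ∀ z ∈ D, extDeriv (fun w => twoForm (Om w)) z = 0

/-- The component `(i, j, k)` of the Schouten bracket `[P, P]` of a bivector `P`
(up to the usual normalizing constant):
`∑ l, (P^{il} ∂_l P^{jk} + P^{jl} ∂_l P^{ki} + P^{kl} ∂_l P^{ij})`. -/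
def schouten (P : (K → ℝ) → Matrix K K ℝ) (z : K → ℝ) (i j k : K) : ℝ :=
  ∑ l, (P z i l * differential (fun w => P w j k) z l
    + P z j l * differential (fun w => P w k i) z l
    + P z k l * differential (fun w => P w i j) z l)

/-- Poisson tensor on `D`: a smooth bivector with vanishing Schouten bracket,
possibly degenerate. -/
structure IsPoissonOn (D : Set (K → ℝ)) (P : (K → ℝ) → Matrix K K ℝ) : Prop
    extends IsSmoothSkewOn D P where
  schouten_eq_zero : ∀ z ∈ D, ∀ i j k, schouten P z i j k = 0

/-- The pointwise kernel of the operator with matrix `A`. -/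
def kernel (A : Matrix K K ℝ) : Submodule ℝ (K → ℝ) :=
  LinearMap.ker A.mulVecLin

/-- `(P, Om)` is a dual Poisson-presymplectic pair of co-rank `r` on `D`, realized by the functions
`c_1, …, c_r` and the vector fields `Z_1, …, Z_r`. -/
structure IsDualPairWith {r : ℕ} (D : Set (K → ℝ)) (P Om : (K → ℝ) → Matrix K K ℝ)
    (c : Fin r → (K → ℝ) → ℝ) (Z : Fin r → (K → ℝ) → K → ℝ) : Prop where
  poisson : IsPoissonOn D P
  presymplectic : IsPresymplecticOn D Om
  smooth_c : ∀ i, ContDiffOn ℝ ∞ (c i) D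
  smooth_Z : ∀ i, ContDiffOn ℝ ∞ (Z i) D
  linearIndependent_Z : ∀ z ∈ D, LinearIndependent ℝ (fun i => Z i z)
  ker_poisson : ∀ z ∈ D,
    kernel (P z) = Submodule.span ℝ (Set.range fun i => differential (c i) z)
  ker_presymplectic : ∀ z ∈ D, kernel (Om z) = Submodule.span ℝ (Set.range fun i => Z i z)
  pairing : ∀ z ∈ D, ∀ i j, Z i z ⬝ᵥ differential (c j) z = if i = j then 1 else 0
  unity_tangent : ∀ z ∈ D,
    1 = P z * Om z + ∑ i, Matrix.vecMulVec (Z i z) (differential (c i) z)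
  unity_cotangent : ∀ z ∈ D,
    1 = Om z * P z + ∑ i, Matrix.vecMulVec (differential (c i) z) (Z i z)

/-- `(P, Om)` is a dual Poisson-presymplectic pair of co-rank `r` on `D`. -/
def IsDualPair (r : ℕ) (D : Set (K → ℝ)) (P Om : (K → ℝ) → Matrix K K ℝ) : Prop :=
  ∃ (c : Fin r → (K → ℝ) → ℝ) (Z : Fin r → (K → ℝ) → K → ℝ), IsDualPairWith D P Om c Z

/-- The closed two-forms `Om0` and `Om1` are d-compatible with respect to the Poisson tensor `P0`:
`P0` is dual to `Om0` and `P0 Om1 P0` is Poisson. -/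
structure IsDCompatible (r : ℕ) (D : Set (K → ℝ)) (Om0 Om1 P0 : (K → ℝ) → Matrix K K ℝ) :
    Prop where
  presymplectic_zero : IsPresymplecticOn D Om0
  presymplectic_one : IsPresymplecticOn D Om1
  dual : IsDualPair r D P0 Om0
  poisson : IsPoissonOn D (fun z => P0 z * Om1 z * P0 z)

end Presymplectic

/-! ### Stäckel systems -/

open Presymplectic

/-- The number `n_1 + ⋯ + n_r` of degrees of freedom. -/
abbrev StackelDof {r : ℕ} (n : Fin r → ℕ) : ℕ := ∑ k, n k

/-- The coordinates `(λ, μ)` on the phase space `M`. -/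
abbrev PhaseIdx {r : ℕ} (n : Fin r → ℕ) : Type := Fin (StackelDof n) ⊕ Fin (StackelDof n)

/-- The coordinates `(λ, μ, c)` on the extended phase space. -/
abbrev ExtIdx {r : ℕ} (n : Fin r → ℕ) : Type := PhaseIdx n ⊕ Fin r

/-- Coefficients of separation relations
`∑ k, φ_j^k(λ^j, μ_j) h^{(k)}(λ^j) = ψ_j(λ^j, μ_j)`, with
`h^{(k)}(x) = ∑_{i=1}^{n_k} x^{n_k - i} h_i^{(k)}`. -/
structure StackelData {r : ℕ} (n : Fin r → ℕ) where
  φ : Fin (StackelDof n) → Fin r → ℝ × ℝ → ℝ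
  ψ : Fin (StackelDof n) → ℝ × ℝ → ℝ

namespace StackelData

variable {r : ℕ} {n : Fin r → ℕ} (S : StackelData n)

/-- The pair `(λ^j, μ_j)`. -/
def pair (z : PhaseIdx n → ℝ) (j : Fin (StackelDof n)) : ℝ × ℝ :=
  (z (Sum.inl j), z (Sum.inr j))

/-- `∑_{i=1}^{n_k} x^{n_k - i} a_i`; here `i : Fin (n k)` is zero-based,
so the exponent is `n_k - (i + 1)`. -/
def chainPoly {k : Fin r} (a : Fin (n k) → ℝ) (x : ℝ) : ℝ :=
  ∑ i : Fin (n k), x ^ (n k - (i.val + 1)) * a i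

/-- `a` solves the linear system `∑ k, φ_j^k(λ^j, μ_j) a^{(k)}(λ^j) = b_j` at the point `z`. -/
def Solves (z : PhaseIdx n → ℝ) (a : (k : Fin r) → Fin (n k) → ℝ)
    (b : Fin (StackelDof n) → ℝ) : Prop :=
  ∀ j, ∑ k, S.φ j k (pair z j) * chainPoly (a k) (z (Sum.inl j)) = b j

/-- The generalized Stäckel matrix, i.e. the matrix of the above linear system. Its columns are
indexed by the pairs `(k, i)`, enumerated by `finSigmaFinEquiv`. -/
def matrix (z : PhaseIdx n → ℝ) : Matrix (Fin (StackelDof n)) (Fin (StackelDof n)) ℝ :=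
  fun j m =>
    S.φ j (finSigmaFinEquiv.symm m).1 (pair z j) *
      z (Sum.inl j) ^ (n (finSigmaFinEquiv.symm m).1 - ((finSigmaFinEquiv.symm m).2.val + 1))

/-- The right-hand side `ψ_j(λ^j, μ_j)` of the separation relations. -/
def rhsH (z : PhaseIdx n → ℝ) : Fin (StackelDof n) → ℝ :=
  fun j => S.ψ j (pair z j)

/-- The right-hand side `φ_j^l(λ^j, μ_j) (λ^j)^{n_l}` of the system for `F^{(k,l)}`. -/
def rhsF (l : Fin r) (z : PhaseIdx n → ℝ) : Fin (StackelDof n) → ℝ :=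
  fun j => S.φ j l (pair z j) * z (Sum.inl j) ^ n l

/-- The Stäckel Hamiltonians `h_{i+1}^{(k)}` on `M`. -/
def h (k : Fin r) (i : Fin (n k)) (z : PhaseIdx n → ℝ) : ℝ :=
  ((S.matrix z)⁻¹ *ᵥ S.rhsH z) (finSigmaFinEquiv ⟨k, i⟩)

/-- The expansion coefficients `F_{i+1}^{(k,l)}` on `M`. -/
def F (k l : Fin r) (i : Fin (n k)) (z : PhaseIdx n → ℝ) : ℝ :=
  ((S.matrix z)⁻¹ *ᵥ S.rhsF l z) (finSigmaFinEquiv ⟨k, i⟩)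

/-- `S` is a Stäckel system on the open set `U` of the phase space: the coefficients are smooth and
the separation relations can be solved for the Hamiltonians. -/
structure IsSystemOn (U : Set (PhaseIdx n → ℝ)) : Prop where
  isOpen : IsOpen U
  smooth_φ : ∀ j k, ∀ z ∈ U, ContDiffAt ℝ ∞ (S.φ j k) (pair z j)
  smooth_ψ : ∀ j, ∀ z ∈ U, ContDiffAt ℝ ∞ (S.ψ j) (pair z j)
  det_ne_zero : ∀ z ∈ U, (S.matrix z).det ≠ 0

end StackelData

/-! ### Tensors on `M` and their lifts to the extended space -/

namespace StackelLift

variable {r : ℕ} (n : Fin r → ℕ)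

/-- `π_0 = ∑ ∂/∂λ^i ∧ ∂/∂μ_i`. -/
def poisson0 (_z : PhaseIdx n → ℝ) : Matrix (PhaseIdx n) (PhaseIdx n) ℝ :=
  ∑ i, wedge (Pi.single (Sum.inl i) 1) (Pi.single (Sum.inr i) 1)

/-- `π_1 = ∑ λ^i ∂/∂λ^i ∧ ∂/∂μ_i`. -/
def poisson1 (z : PhaseIdx n → ℝ) : Matrix (PhaseIdx n) (PhaseIdx n) ℝ :=
  ∑ i, z (Sum.inl i) • wedge (Pi.single (Sum.inl i) 1) (Pi.single (Sum.inr i) 1)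

/-- `ω_0 = -∑ dλ^i ∧ dμ_i`. -/
def omega0 (_z : PhaseIdx n → ℝ) : Matrix (PhaseIdx n) (PhaseIdx n) ℝ :=
  -∑ i, wedge (Pi.single (Sum.inl i) 1) (Pi.single (Sum.inr i) 1)

/-- `ω_1 = -∑ λ^i dλ^i ∧ dμ_i`. -/
def omega1 (z : PhaseIdx n → ℝ) : Matrix (PhaseIdx n) (PhaseIdx n) ℝ :=
  -∑ i, z (Sum.inl i) • wedge (Pi.single (Sum.inl i) 1) (Pi.single (Sum.inr i) 1)

variable {n}

/-- The projection `(λ, μ, c) ↦ (λ, μ)`. -/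
def base (w : ExtIdx n → ℝ) : PhaseIdx n → ℝ := fun j => w (Sum.inl j)

/-- The domain `U × ℝ^r` of the extended space. -/
def domain (U : Set (PhaseIdx n → ℝ)) : Set (ExtIdx n → ℝ) := base ⁻¹' U

/-- The lift of a function on `M` (constant in `c`). -/
def liftFun (f : (PhaseIdx n → ℝ) → ℝ) (w : ExtIdx n → ℝ) : ℝ := f (base w)

/-- The lift of a vector field on `M` (no component along `∂/∂c`). -/
def liftVec (x : (PhaseIdx n → ℝ) → PhaseIdx n → ℝ) (w : ExtIdx n → ℝ) : ExtIdx n → ℝ :=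
  Sum.elim (x (base w)) 0

/-- The lift of a two-form or of a bivector on `M`. -/
def liftTensor (A : (PhaseIdx n → ℝ) → Matrix (PhaseIdx n) (PhaseIdx n) ℝ)
    (w : ExtIdx n → ℝ) : Matrix (ExtIdx n) (ExtIdx n) ℝ :=
  Matrix.fromBlocks (A (base w)) 0 0 0

variable (n)

/-- `Π_0`. -/
def Poisson0 : (ExtIdx n → ℝ) → Matrix (ExtIdx n) (ExtIdx n) ℝ := liftTensor (poisson0 n)

/-- `Π_{1D}`. -/
def Poisson1D : (ExtIdx n → ℝ) → Matrix (ExtIdx n) (ExtIdx n) ℝ := liftTensor (poisson1 n)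

/-- `Ω_0`. -/
def Omega0 : (ExtIdx n → ℝ) → Matrix (ExtIdx n) (ExtIdx n) ℝ := liftTensor (omega0 n)

/-- `Ω_{1D}`. -/
def Omega1D : (ExtIdx n → ℝ) → Matrix (ExtIdx n) (ExtIdx n) ℝ := liftTensor (omega1 n)

/-- The coordinate function `c_k`. -/
def cCoord (k : Fin r) (w : ExtIdx n → ℝ) : ℝ := w (Sum.inr k)

/-- `Y_0^{(k)} = ∂/∂c_k`. -/
def Y0 (k : Fin r) (_w : ExtIdx n → ℝ) : ExtIdx n → ℝ := Pi.single (Sum.inr k) 1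

variable {n} (S : StackelData n)

/-- `Ω_1 = Ω_{1D} + ∑ k, dh_1^{(k)} ∧ dc_k`. -/
def Omega1 (hn : ∀ k, 0 < n k) (w : ExtIdx n → ℝ) : Matrix (ExtIdx n) (ExtIdx n) ℝ :=
  Omega1D n w +
    ∑ k, wedge (differential (liftFun (S.h k ⟨0, hn k⟩)) w) (differential (cCoord n k) w)

/-- `X_{i+1}^{(k)}`, the lift of `x_{i+1}^{(k)} = π_0 dh_{i+1}^{(k)}`. -/
def X (k : Fin r) (i : Fin (n k)) : (ExtIdx n → ℝ) → ExtIdx n → ℝ :=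
  liftVec fun z => poisson0 n z *ᵥ differential (S.h k i) z

/-- The chain `Y_0^{(k)}, Y_1^{(k)}, …, Y_{n_k}^{(k)}`, where
`Y_i^{(k)} = X_i^{(k)} - ∑ l, F_i^{(k,l)} Y_0^{(l)}` for `1 ≤ i ≤ n_k`. -/
def Y (k : Fin r) : Fin (n k + 1) → (ExtIdx n → ℝ) → ExtIdx n → ℝ :=
  Fin.cases (Y0 n k) fun i w => X S k i w - ∑ l, liftFun (S.F k l i) w • Y0 n l w

end StackelLift

end

/-! ### Tensor calculus in components; closedness from potentials -/

namespace Presymplectic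

variable {K : Type}

/-! Let `A` be the Stäckel matrix and `B` its inverse. Separation enters in one way: row `j` of `A`
and the right-hand side `ψ_j` depend on `(λ^j, μ_j)` only. Differentiating `A h = ψ` gives `A dh =
g`, where `g_j` is a combination of `dλ^j` and `dμ_j` alone. Hence `∂h_m/∂λ^j = B_mj u_j` and
`∂h_m/∂μ_j = B_mj v_j`, with `u`, `v` independent of `m` (`exists_differential_h`). Involution
follows at once, since each bracket summand is `B_mj B_m'j (u_j v_j - v_j u_j)`.

The chain comes from the monomials in `A`. Multiplying row `j` by `λ^j` turns each non-leading
column of a block into the preceding one, and the leading column of block `l` into the right-hand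
side defining `F^{(k,l)}`. Thus `B Λ A`, with `Λ = diag(λ^j)`, is a block shift plus columns of
`F`'s. Undoing `A` gives a recursion for the rows of `B` (`inv_matrix_recursion`), and scaling by
`u_j`, `v_j` gives `Λ dh_i^{(k)} = dh_{i+1}^{(k)} + ∑ l, F_i^{(k,l)} dh_1^{(l)}`, where `Λ` acts on
both the `dλ^j` and the `dμ_j` components and `dh_{n_k+1}^{(k)}` means `0`. This is the phase-space
part of `Ω_1 Y_i = dh_{i+1}`; its `c` components vanish by involution.

The rest is canonical. Both two-forms have explicit potentials, so `d ∘ d = 0` closes them.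
Sandwiching `Ω_1` between two `Π_0` removes the `dh ∧ dc` terms and leaves `Π_{1D}`, whose entries
are `0` or `±λ^a`, so its Schouten bracket is a finite check. -/

theorem wedge_mulVec [Fintype K] (a b v : K → ℝ) :
    wedge a b *ᵥ v = (b ⬝ᵥ v) • a - (a ⬝ᵥ v) • b := by
  rw [wedge, Matrix.sub_mulVec]
  ext i
  simp [Matrix.vecMulVec_mulVec]

theorem wedge_transpose (a b : K → ℝ) : (wedge a b)ᵀ = -wedge a b := by
  simp [wedge, Matrix.transpose_vecMulVec]

theorem dotProduct_differential [Fintype K] [DecidableEq K] (f : (K → ℝ) → ℝ) (z v : K → ℝ) :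
    differential f z ⬝ᵥ v = fderiv ℝ f z v := by
  rw [dotProduct]
  conv_rhs => rw [pi_eq_sum_univ' v]
  simp [differential, mul_comm]

theorem differential_congr [DecidableEq K] {f g : (K → ℝ) → ℝ} {z : K → ℝ} (h : f =ᶠ[nhds z] g) :
    differential f z = differential g z := by
  unfold differential
  rw [h.fderiv_eq]

@[simp]
theorem differential_const [DecidableEq K] (c : ℝ) (z : K → ℝ) :
    differential (fun _ => c) z = 0 := by
  ext j
  simp [differential]

theorem differential_coord [DecidableEq K] (i : K) (z : K → ℝ) :
    differential (fun w => w i) z = Pi.single i 1 := by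
  ext j
  have : HasFDerivAt (fun w : K → ℝ => w i)
      (ContinuousLinearMap.proj (R := ℝ) (φ := fun _ : K => ℝ) i) z :=
    (ContinuousLinearMap.proj (R := ℝ) (φ := fun _ : K => ℝ) i).hasFDerivAt
  rw [differential, this.fderiv]
  simp [Pi.single_apply, eq_comm]

theorem differential_of_hasDerivAt [Fintype K] [DecidableEq K] {g : ℝ → ℝ} {g' : ℝ}
    (i : K) (z : K → ℝ)
    (hg : HasDerivAt g g' (z i)) :
    differential (fun w => g (w i)) z = Pi.single i g' := by
  ext j
  have h1 : HasFDerivAt (fun w : K → ℝ => w i)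
      (ContinuousLinearMap.proj (R := ℝ) (φ := fun _ : K => ℝ) i) z :=
    (ContinuousLinearMap.proj (R := ℝ) (φ := fun _ : K => ℝ) i).hasFDerivAt
  have h2 : HasFDerivAt (fun w : K → ℝ => g (w i)) _ z := hg.comp_hasFDerivAt z h1
  rw [differential, h2.fderiv]
  simp [Pi.single_apply, eq_comm]

theorem differential_mul [Fintype K] [DecidableEq K] {f g : (K → ℝ) → ℝ} {z : K → ℝ}
    (hf : DifferentiableAt ℝ f z)
    (hg : DifferentiableAt ℝ g z) :
    differential (fun w => f w * g w) z = f z • differential g z + g z • differential f z := by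
  ext j
  simp [differential, fderiv_fun_mul hf hg]

theorem differential_sum [Fintype K] [DecidableEq K] {ι : Type*} (s : Finset ι)
    {f : ι → (K → ℝ) → ℝ} {z : K → ℝ}
    (hf : ∀ i ∈ s, DifferentiableAt ℝ (f i) z) :
    differential (fun w => ∑ i ∈ s, f i w) z = ∑ i ∈ s, differential (f i) z := by
  ext j
  simp [differential, fderiv_fun_sum hf]

theorem contDiffOn_differential [Fintype K] [DecidableEq K] {f : (K → ℝ) → ℝ} {D : Set (K → ℝ)}
    (hD : IsOpen D) (hf : ContDiffOn ℝ ∞ f D) (j : K) : ContDiffOn ℝ ∞ (fun z => differential f z j) D := by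
  have h1 : ContDiffOn ℝ ∞ (fderiv ℝ f) D := hf.fderiv_of_isOpen hD (by simp)
  exact h1.clm_apply contDiffOn_const

theorem basicTwoForm_apply [Fintype K] (i j : K) (v : Fin 2 → K → ℝ) :
    basicTwoForm i j v = v 0 i * v 1 j - v 1 i * v 0 j := by
  rw [basicTwoForm, ContinuousAlternatingMap.alternatizeUncurryFin_apply, Fin.sum_univ_two]
  have h : Fin.tail v 0 = v 1 := rfl
  simp [Fin.removeNth, sub_eq_add_neg, h]

theorem twoForm_add [Fintype K] (A B : Matrix K K ℝ) : twoForm (A + B) = twoForm A + twoForm B := by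
  simp [twoForm, add_smul, Finset.sum_add_distrib]

theorem twoForm_zero [Fintype K] : twoForm (0 : Matrix K K ℝ) = 0 := by
  simp [twoForm]

theorem twoForm_sum [Fintype K] {ι : Type*} (s : Finset ι) (A : ι → Matrix K K ℝ) :
    twoForm (∑ k ∈ s, A k) = ∑ k ∈ s, twoForm (A k) := by
  classical
  induction s using Finset.induction_on with
  | empty => simp [twoForm_zero]
  | insert a s ha ih => rw [Finset.sum_insert ha, Finset.sum_insert ha, twoForm_add, ih]

/-- The factor `1/2` in `twoForm` compensates for the sum over ordered pairs, which counts every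
basic form twice. -/
theorem twoForm_wedge_apply [Fintype K] (a b : K → ℝ) (v : Fin 2 → K → ℝ) :
    twoForm (wedge a b) v = (a ⬝ᵥ v 0) * (b ⬝ᵥ v 1) - (a ⬝ᵥ v 1) * (b ⬝ᵥ v 0) := by
  have h : ∀ a b x y : K → ℝ, ∑ i, ∑ j, a i * b j * (x i * y j) = (a ⬝ᵥ x) * (b ⬝ᵥ y) := by
    intro a b x y
    rw [dotProduct, dotProduct, Finset.sum_mul_sum]
    exact Finset.sum_congr rfl fun i _ => Finset.sum_congr rfl fun j _ => by ring
  have e : ∀ i j, wedge a b i j * (v 0 i * v 1 j - v 1 i * v 0 j) =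
      a i * b j * (v 0 i * v 1 j) - a i * b j * (v 1 i * v 0 j)
        - b i * a j * (v 0 i * v 1 j) + b i * a j * (v 1 i * v 0 j) := by
    intro i j
    simp only [wedge, Matrix.sub_apply, Matrix.vecMulVec_apply]
    ring
  simp only [twoForm, ContinuousAlternatingMap.smul_apply, ContinuousAlternatingMap.sum_apply,
    basicTwoForm_apply, smul_eq_mul, e, Finset.sum_add_distrib, Finset.sum_sub_distrib, h]
  ring

/-- The one-form `dx^k`. -/
noncomputable def coordForm [Fintype K] (k : K) : (K → ℝ) [⋀^Fin 1]→L[ℝ] ℝ :=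
  ContinuousAlternatingMap.ofSubsingleton ℝ (K → ℝ) ℝ (0 : Fin 1)
    (ContinuousLinearMap.proj (R := ℝ) (φ := fun _ : K => ℝ) k)

/-- Bridge between component matrices and the exterior derivative: a matrix field of this shape is
exact. -/
theorem extDeriv_sum_smul_coordForm [Fintype K] [DecidableEq K] {f : K → (K → ℝ) → ℝ} {z : K → ℝ}
    (hf : ∀ k, DifferentiableAt ℝ (f k) z) :
    extDeriv (fun w => ∑ k, f k w • coordForm k) z =
      twoForm (∑ k, wedge (differential (f k) z) (Pi.single k 1)) := by
  ext v
  rw [extDeriv_apply (DifferentiableAt.fun_sum fun k _ => (hf k).smul_const _), twoForm_sum]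
  simp only [ContinuousAlternatingMap.sum_apply, twoForm_wedge_apply, dotProduct_differential,
    ContinuousAlternatingMap.smul_apply, single_one_dotProduct]
  have h : ∀ y : Fin 1 → K → ℝ, ∀ u, fderiv ℝ (fun x => ∑ k, f k x • coordForm k y) z u =
      ∑ k, fderiv ℝ (f k) z u * y 0 k := by
    intro y u
    simp only [smul_eq_mul]
    rw [fderiv_fun_sum fun k _ => (hf k).mul_const _]
    rw [sum_apply]
    refine Finset.sum_congr rfl fun k _ => ?_
    rw [fderiv_mul_const (hf k)]
    simp [coordForm, mul_comm]
  simp only [h]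
  simp [Fin.removeNth, sub_eq_add_neg, Finset.sum_add_distrib]

/-- A field of two-forms with a smooth potential `∑ k, f k dx^k` is presymplectic. -/
theorem isPresymplecticOn_of_potential [Fintype K] [DecidableEq K] {D : Set (K → ℝ)} (hD : IsOpen D)
    {Om : (K → ℝ) → Matrix K K ℝ} {f : K → (K → ℝ) → ℝ} (hf : ∀ k, ContDiffOn ℝ ∞ (f k) D)
    (hOm : ∀ z ∈ D, Om z = ∑ k, wedge (differential (f k) z) (Pi.single k 1)) :
    IsPresymplecticOn D Om where
  smooth i j := by
    have : ContDiffOn ℝ ∞ (fun z => ∑ k, (differential (f k) z i * (Pi.single k 1 : K → ℝ) j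
        - (Pi.single k 1 : K → ℝ) i * differential (f k) z j)) D :=
      ContDiffOn.sum fun k _ =>
        ((contDiffOn_differential hD (hf k) i).mul contDiffOn_const).sub
          (contDiffOn_const.mul (contDiffOn_differential hD (hf k) j))
    refine this.congr fun z hz => ?_
    simp [hOm z hz, Matrix.sum_apply, wedge, Matrix.vecMulVec_apply]
  skew z hz := by
    rw [hOm z hz, Matrix.transpose_sum, ← Finset.sum_neg_distrib]
    exact Finset.sum_congr rfl fun k _ => wedge_transpose _ _
  closed z hz := by
    have hd : ∀ y ∈ D, ∀ k, ContDiffAt ℝ ∞ (f k) y := fun y hy k =>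
      (hf k).contDiffAt (hD.mem_nhds hy)
    -- Agreement at `z` alone would not suffice: the exterior derivative sees a neighbourhood, and
    -- openness of `D` supplies one.
    have h1 : (fun w => twoForm (Om w)) =ᶠ[nhds z]
        extDeriv (fun w => ∑ k, f k w • coordForm k) := by
      filter_upwards [hD.mem_nhds hz] with y hy
      rw [extDeriv_sum_smul_coordForm fun k => (hd y hy k).differentiableAt (by simp), hOm y hy]
    rw [h1.extDeriv_eq]
    refine extDeriv_extDeriv_apply (r := ∞) ?_ (by
      rw [minSmoothness_of_isRCLikeNormedField]
      exact WithTop.coe_le_coe.2 (le_top : (2 : ℕ∞) ≤ ⊤))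
    exact ContDiffAt.sum fun k _ => (hd z hz k).smul contDiffAt_const

end Presymplectic

open Presymplectic

/-! ### The canonical tensors, their lifts, and the dual pair -/

namespace StackelLift

variable {r : ℕ} {n : Fin r → ℕ}

theorem contDiff_base : ContDiff ℝ ∞ (base : (ExtIdx n → ℝ) → PhaseIdx n → ℝ) :=
  contDiff_pi.2 fun j => contDiff_apply ℝ ℝ (Sum.inl j)

theorem isOpen_domain {U : Set (PhaseIdx n → ℝ)} (hU : IsOpen U) : IsOpen (domain U) :=
  hU.preimage contDiff_base.continuous

theorem contDiffOn_liftFun {U : Set (PhaseIdx n → ℝ)} {f : (PhaseIdx n → ℝ) → ℝ}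
    (hf : ContDiffOn ℝ ∞ f U) : ContDiffOn ℝ ∞ (liftFun f) (domain U) :=
  hf.comp contDiff_base.contDiffOn fun _ hw => hw

theorem differential_liftFun {f : (PhaseIdx n → ℝ) → ℝ} {w : ExtIdx n → ℝ}
    (hf : DifferentiableAt ℝ f (base w)) :
    differential (liftFun f) w = Sum.elim (differential f (base w)) 0 := by
  have hb : HasFDerivAt (base : (ExtIdx n → ℝ) → PhaseIdx n → ℝ)
      (ContinuousLinearMap.pi fun j => ContinuousLinearMap.proj (Sum.inl j)) w :=
    hasFDerivAt_pi.2 fun j =>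
      (ContinuousLinearMap.proj (R := ℝ) (φ := fun _ : ExtIdx n => ℝ) (Sum.inl j)).hasFDerivAt
  have h : HasFDerivAt (liftFun f) _ w := hf.hasFDerivAt.comp w hb
  ext j
  rw [differential, h.fderiv]
  rcases j with j | k
  · simp only [ContinuousLinearMap.comp_apply, Sum.elim_inl, differential]
    congr 1
    ext i
    simp [Pi.single_apply]
  · simp only [ContinuousLinearMap.comp_apply, Sum.elim_inr, Pi.zero_apply]
    convert map_zero (fderiv ℝ f (base w)) using 2
    ext i
    simp

theorem liftTensor_mulVec (A : (PhaseIdx n → ℝ) → Matrix (PhaseIdx n) (PhaseIdx n) ℝ)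
    (w v : ExtIdx n → ℝ) :
    liftTensor A w *ᵥ v = Sum.elim (A (base w) *ᵥ base v) 0 := by
  conv_lhs => rw [liftTensor, ← Sum.elim_comp_inl_inr v, Matrix.fromBlocks_mulVec]
  simp [Function.comp_def]
  rfl

/-- The common computation behind `π_0`, `π_1`, `ω_0` and `ω_1`. Later matrix identities are checked
through this action on vectors rather than entrywise. -/
theorem sum_smul_wedge_mulVec {m : ℕ} (a : Fin m → ℝ) (v : Fin m ⊕ Fin m → ℝ) :
    (∑ i, a i • wedge (Pi.single (Sum.inl i) 1) (Pi.single (Sum.inr i) 1)) *ᵥ v =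
      Sum.elim (fun i => a i * v (Sum.inr i)) (fun i => -(a i * v (Sum.inl i))) := by
  rw [Matrix.sum_mulVec]
  simp only [Matrix.smul_mulVec, wedge_mulVec, single_one_dotProduct]
  ext (i | i) <;> simp [Pi.single_apply, Finset.sum_apply]

theorem poisson1_mulVec (z v : PhaseIdx n → ℝ) :
    poisson1 n z *ᵥ v = Sum.elim (fun i => z (Sum.inl i) * v (Sum.inr i))
      (fun i => -(z (Sum.inl i) * v (Sum.inl i))) :=
  sum_smul_wedge_mulVec _ _

theorem omega1_mulVec (z v : PhaseIdx n → ℝ) :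
    omega1 n z *ᵥ v = Sum.elim (fun i => -(z (Sum.inl i) * v (Sum.inr i)))
      (fun i => z (Sum.inl i) * v (Sum.inl i)) := by
  rw [omega1, Matrix.neg_mulVec, sum_smul_wedge_mulVec]
  ext (i | i) <;> simp

theorem poisson0_mulVec (z v : PhaseIdx n → ℝ) :
    poisson0 n z *ᵥ v = Sum.elim (fun i => v (Sum.inr i)) (fun i => -v (Sum.inl i)) := by
  simpa [poisson0] using sum_smul_wedge_mulVec (fun _ => 1) v

theorem omega0_mulVec (z v : PhaseIdx n → ℝ) :
    omega0 n z *ᵥ v = Sum.elim (fun i => -v (Sum.inr i)) (fun i => v (Sum.inl i)) := by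
  rw [omega0, Matrix.neg_mulVec, ← poisson0, poisson0_mulVec z]
  ext (i | i) <;> simp

theorem differential_cCoord (k : Fin r) (w : ExtIdx n → ℝ) :
    differential (cCoord n k) w = Pi.single (Sum.inr k) 1 :=
  differential_coord _ _

theorem liftTensor_apply_of_mulVec {A : (PhaseIdx n → ℝ) → Matrix (PhaseIdx n) (PhaseIdx n) ℝ}
    {w : ExtIdx n → ℝ} (i j : ExtIdx n) :
    liftTensor A w i j = (Sum.elim (A (base w) *ᵥ base (Pi.single j 1)) 0 : ExtIdx n → ℝ) i := by
  rw [← liftTensor_mulVec]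
  simp

theorem Poisson1D_apply (w : ExtIdx n → ℝ) (i j : ExtIdx n) :
    Poisson1D n w i j = (Sum.elim (Sum.elim
      (fun a => if j = Sum.inl (Sum.inr a) then w (Sum.inl (Sum.inl a)) else 0)
      (fun a => if j = Sum.inl (Sum.inl a) then -w (Sum.inl (Sum.inl a)) else 0)) 0 :
        ExtIdx n → ℝ) i := by
  rw [Poisson1D, liftTensor_apply_of_mulVec, poisson1_mulVec]
  rcases i with (i | i) | i <;> simp [base, Pi.single_apply, eq_comm (a := j)]
  split_ifs <;> simp

theorem Poisson0_apply (w : ExtIdx n → ℝ) (i j : ExtIdx n) :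
    Poisson0 n w i j = (Sum.elim (Sum.elim
      (fun a => if j = Sum.inl (Sum.inr a) then 1 else 0)
      (fun a => if j = Sum.inl (Sum.inl a) then -1 else 0)) 0 : ExtIdx n → ℝ) i := by
  rw [Poisson0, liftTensor_apply_of_mulVec, poisson0_mulVec]
  rcases i with (i | i) | i <;> simp [base, Pi.single_apply, eq_comm (a := j)]
  split_ifs <;> simp

theorem isPoissonOn_Poisson0 (D : Set (ExtIdx n → ℝ)) : IsPoissonOn D (Poisson0 n) where
  smooth i j := by
    simp only [Poisson0_apply]
    exact contDiffOn_const
  skew w _ := by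
    ext i j
    simp only [Matrix.transpose_apply, Matrix.neg_apply, Poisson0_apply]
    rcases i with (i | i) | i <;> rcases j with (j | j) | j <;> simp [eq_comm]
    all_goals split_ifs <;> simp
  schouten_eq_zero w _ i j k := by
    simp only [schouten, Poisson0_apply, differential_const]
    simp

theorem contDiff_Poisson1D (i j : ExtIdx n) : ContDiff ℝ ∞ (fun w => Poisson1D n w i j) := by
  simp only [Poisson1D_apply]
  rcases i with (i | i) | i <;> simp only [Sum.elim_inl, Sum.elim_inr, Pi.zero_apply]
  · split_ifs
    · exact contDiff_apply ℝ ℝ _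
    · exact contDiff_const
  · split_ifs
    · exact (contDiff_apply ℝ ℝ _).neg
    · exact contDiff_const
  · exact contDiff_const

theorem differential_Poisson1D (w : ExtIdx n → ℝ) (i j : ExtIdx n) :
    differential (fun w => Poisson1D n w i j) w = (Sum.elim (Sum.elim
      (fun a => if j = Sum.inl (Sum.inr a) then Pi.single (Sum.inl (Sum.inl a)) 1 else 0)
      (fun a => if j = Sum.inl (Sum.inl a) then Pi.single (Sum.inl (Sum.inl a)) (-1) else 0)) 0 :
        ExtIdx n → ExtIdx n → ℝ) i := by
  simp only [Poisson1D_apply]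
  rcases i with (i | i) | i <;> simp only [Sum.elim_inl, Sum.elim_inr, Pi.zero_apply]
  · split_ifs
    · exact differential_coord _ _
    · exact differential_const _ _
  · split_ifs
    · exact differential_of_hasDerivAt _ _ (hasDerivAt_neg _)
    · exact differential_const _ _
  · exact differential_const _ _

theorem isPoissonOn_Poisson1D (D : Set (ExtIdx n → ℝ)) : IsPoissonOn D (Poisson1D n) where
  smooth i j := (contDiff_Poisson1D i j).contDiffOn
  skew w _ := by
    ext i j
    simp only [Matrix.transpose_apply, Matrix.neg_apply, Poisson1D_apply]
    rcases i with (i | i) | i <;> rcases j with (j | j) | j <;> simp [eq_comm]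
    all_goals split_ifs <;> simp_all
  schouten_eq_zero w _ i j k := by
    simp only [schouten, Finset.sum_add_distrib]
    change (Poisson1D n w i ⬝ᵥ differential (fun w => Poisson1D n w j k) w)
      + (Poisson1D n w j ⬝ᵥ differential (fun w => Poisson1D n w k i) w)
      + (Poisson1D n w k ⬝ᵥ differential (fun w => Poisson1D n w i j) w) = 0
    simp only [differential_Poisson1D]
    have hd : ∀ (u : ExtIdx n → ℝ) (p : Prop) [Decidable p] (l : ExtIdx n) (a : ℝ),
        (u ⬝ᵥ if p then Pi.single l a else 0) = if p then u l * a else 0 := by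
      intro u p _ l a
      split_ifs <;> simp
    -- Up to order, only triples `(λ^a, μ_a, μ_a)` give nonzero terms, and there two terms cancel.
    rcases i with (i | i) | i <;> rcases j with (j | j) | j <;> rcases k with (k | k) | k <;>
      simp [hd, Poisson1D_apply]
    all_goals grind

/-- On a vector `u` in the image of `Π_0`, `(dh ∧ dc) u = (dc·u) dh - (dh·u) dc`. The first
coefficient vanishes because `u` has no `c` component, and the second term is killed by the left
`Π_0`. Only `Ω_{1D}` contributes. -/
theorem Poisson0_mul_Omega1_mul_Poisson0 (S : StackelData n) (hn : ∀ k, 0 < n k)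
    (w : ExtIdx n → ℝ) :
    Poisson0 n w * Omega1 S hn w * Poisson0 n w = Poisson1D n w := by
  have hc : ∀ k, Poisson0 n w *ᵥ Pi.single (Sum.inr k) 1 = 0 := by
    intro k
    rw [Poisson0, liftTensor_mulVec, poisson0_mulVec]
    ext ((i | i) | i) <;> simp [base]
  have hc' : ∀ v k, (Poisson0 n w *ᵥ v) (Sum.inr k) = 0 := by
    intro v k
    rw [Poisson0, liftTensor_mulVec]
    simp
  refine Matrix.ext_of_mulVec_single fun i => ?_
  rw [← Matrix.mulVec_mulVec, ← Matrix.mulVec_mulVec]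
  set u := Poisson0 n w *ᵥ Pi.single i 1 with hu
  rw [Omega1, Matrix.add_mulVec, Matrix.mulVec_add, Matrix.sum_mulVec, Matrix.mulVec_sum]
  rw [Finset.sum_eq_zero, add_zero]
  · rw [hu]
    simp only [Poisson0, Poisson1D, Omega1D, liftTensor_mulVec, poisson0_mulVec, poisson1_mulVec,
      omega1_mulVec]
    ext ((i | i) | i) <;> simp [base]
  · intro k _
    rw [wedge_mulVec, differential_cCoord, single_one_dotProduct, hu, hc', zero_smul, zero_sub,
      Matrix.mulVec_neg, Matrix.mulVec_smul, hc, smul_zero, neg_zero]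

theorem kernel_Omega1D_eq {w : ExtIdx n → ℝ} (hw : ∀ j, base w (Sum.inl j) ≠ 0) :
    kernel (Omega1D n w) = kernel (Omega0 n w) := by
  ext v
  simp only [kernel, LinearMap.mem_ker, Matrix.mulVecLin_apply, Omega1D, Omega0,
    liftTensor_mulVec, omega1_mulVec, omega0_mulVec]
  simp [funext_iff, hw]

theorem kernel_Poisson1D_eq {w : ExtIdx n → ℝ} (hw : ∀ j, base w (Sum.inl j) ≠ 0) :
    kernel (Poisson1D n w) = kernel (Poisson0 n w) := by
  ext v
  simp only [kernel, LinearMap.mem_ker, Matrix.mulVecLin_apply, Poisson1D, Poisson0,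
    liftTensor_mulVec, poisson1_mulVec, poisson0_mulVec]
  simp [funext_iff, hw]

/-- Serves both kernels, since `dc_k` and `∂/∂c_k` have the same components. -/
theorem mem_span_single_inr_iff (v : ExtIdx n → ℝ) :
    v ∈ Submodule.span ℝ (Set.range fun k : Fin r =>
      (Pi.single (Sum.inr k) 1 : ExtIdx n → ℝ)) ↔ base v = 0 := by
  constructor
  · intro hv
    induction hv using Submodule.span_induction with
    | mem x hx =>
      obtain ⟨k, rfl⟩ := hx
      ext j
      simp [base]
    | zero => rfl
    | add x y _ _ hx hy =>
      ext j
      simpa [base] using congr($(congrFun hx j) + $(congrFun hy j))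
    | smul a x _ hx =>
      ext j
      simpa [base] using Or.inr (congrFun hx j)
  · intro hv
    rw [pi_eq_sum_univ' v, Fintype.sum_sum_type]
    refine Submodule.add_mem _ ?_ ?_
    · rw [Finset.sum_eq_zero]
      · exact Submodule.zero_mem _
      · intro j _
        rw [show v (Sum.inl j) = 0 from congrFun hv j, zero_smul]
    · refine Submodule.sum_mem _ fun k _ => Submodule.smul_mem _ _ (Submodule.subset_span ⟨k, ?_⟩)
      ext j
      simp [Pi.single_apply]

theorem kernel_Poisson0 (w : ExtIdx n → ℝ) :
    kernel (Poisson0 n w) =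
      Submodule.span ℝ (Set.range fun k : Fin r => differential (cCoord n k) w) := by
  ext v
  simp only [differential_cCoord, mem_span_single_inr_iff]
  simp only [kernel, LinearMap.mem_ker, Matrix.mulVecLin_apply, Poisson0,
    liftTensor_mulVec, poisson0_mulVec]
  simp [funext_iff, base, and_comm]

theorem kernel_Omega0 (w : ExtIdx n → ℝ) :
    kernel (Omega0 n w) = Submodule.span ℝ (Set.range fun k : Fin r => Y0 n k w) := by
  ext v
  simp only [Y0, mem_span_single_inr_iff]
  simp only [kernel, LinearMap.mem_ker, Matrix.mulVecLin_apply, Omega0,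
    liftTensor_mulVec, omega0_mulVec]
  simp [funext_iff, base, and_comm]

theorem sum_smul_wedge_lift (a : Fin (StackelDof n) → ℝ) :
    ∑ i, wedge (Pi.single (Sum.inl (Sum.inl i)) (a i))
      (Pi.single (Sum.inl (Sum.inr i)) 1 : ExtIdx n → ℝ) =
    Matrix.fromBlocks (∑ i, a i • wedge (Pi.single (Sum.inl i) 1)
      (Pi.single (Sum.inr i) 1 : PhaseIdx n → ℝ)) 0 0 0 := by
  refine Matrix.ext_of_mulVec_single fun j => ?_
  have h := liftTensor_mulVec (n := n) (fun _ => ∑ i, a i • wedge (Pi.single (Sum.inl i) 1)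
      (Pi.single (Sum.inr i) 1 : PhaseIdx n → ℝ)) 0 (Pi.single j 1)
  rw [liftTensor] at h
  rw [h, sum_smul_wedge_mulVec, Matrix.sum_mulVec]
  generalize (Pi.single j 1 : ExtIdx n → ℝ) = v
  simp only [wedge_mulVec, single_dotProduct]
  ext ((i | i) | i) <;> simp [Pi.single_apply, Finset.sum_apply, base, mul_comm]

theorem isPresymplecticOn_Omega0 {D : Set (ExtIdx n → ℝ)} (hD : IsOpen D) :
    IsPresymplecticOn D (Omega0 n) := by
  -- The potential is `-∑ λ^i dμ_i`.
  refine isPresymplecticOn_of_potential hD (f := Sum.elim (Sum.elim (fun _ _ => 0)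
    (fun i w => -w (Sum.inl (Sum.inl i)))) (fun _ _ => 0)) ?_ ?_
  · rintro ((i | i) | i)
    · exact contDiffOn_const
    · exact (contDiff_apply ℝ ℝ _).neg.contDiffOn
    · exact contDiffOn_const
  · intro w _
    have h : ∀ i, differential (fun w : ExtIdx n → ℝ => -w (Sum.inl (Sum.inl i))) w =
        Pi.single (Sum.inl (Sum.inl i)) (-1) := fun i =>
      differential_of_hasDerivAt _ _ (hasDerivAt_neg _)
    simp only [Fintype.sum_sum_type, Sum.elim_inl, Sum.elim_inr, h, differential_const]
    rw [sum_smul_wedge_lift]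
    simp [wedge, Omega0, liftTensor, omega0]

theorem isPresymplecticOn_Omega1 (S : StackelData n) (hn : ∀ k, 0 < n k)
    {U : Set (PhaseIdx n → ℝ)} (hU : IsOpen U) (hS : ∀ k i, ContDiffOn ℝ ∞ (S.h k i) U) :
    IsPresymplecticOn (domain U) (Omega1 S hn) := by
  -- The potential is `-∑ (λ^i)²/2 dμ_i + ∑ h_1^{(k)} dc_k`.
  refine isPresymplecticOn_of_potential (isOpen_domain hU) (f := Sum.elim (Sum.elim (fun _ _ => 0)
    (fun i w => -(w (Sum.inl (Sum.inl i)) ^ 2 / 2))) (fun k => liftFun (S.h k ⟨0, hn k⟩))) ?_ ?_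
  · rintro ((i | i) | k)
    · exact contDiffOn_const
    · exact (((contDiff_apply ℝ ℝ _).pow 2).div_const 2).neg.contDiffOn
    · exact contDiffOn_liftFun (hS _ _)
  · intro w _
    have h : ∀ i, differential (fun w : ExtIdx n → ℝ => -(w (Sum.inl (Sum.inl i)) ^ 2 / 2)) w =
        Pi.single (Sum.inl (Sum.inl i)) (-w (Sum.inl (Sum.inl i))) := fun i => by
      refine differential_of_hasDerivAt (g := fun x => -(x ^ 2 / 2)) _ _ ?_
      exact ((hasDerivAt_pow 2 (w (Sum.inl (Sum.inl i)))).div_const 2).neg.congr_deriv (by simp)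
    simp only [Fintype.sum_sum_type, Sum.elim_inl, Sum.elim_inr, h, differential_const]
    rw [sum_smul_wedge_lift]
    simp [wedge, Omega1, Omega1D, liftTensor, omega1, base, differential_cCoord]

theorem isDualPairWith_Poisson0_Omega0 {D : Set (ExtIdx n → ℝ)} (hD : IsOpen D) :
    IsDualPairWith D (Poisson0 n) (Omega0 n) (cCoord n) (Y0 n) where
  poisson := isPoissonOn_Poisson0 D
  presymplectic := isPresymplecticOn_Omega0 hD
  smooth_c k := (contDiff_apply ℝ ℝ _).contDiffOn
  smooth_Z _ := contDiffOn_const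
  linearIndependent_Z w _ := by
    have := (Pi.basisFun ℝ (ExtIdx n)).linearIndependent.comp Sum.inr Sum.inr_injective
    simpa [Function.comp_def, Y0] using this
  ker_poisson w _ := kernel_Poisson0 w
  ker_presymplectic w _ := kernel_Omega0 w
  pairing w _ i j := by
    simp [differential_cCoord, Y0, Pi.single_apply, eq_comm]
  unity_tangent w _ := by
    refine Matrix.ext_of_mulVec_single fun j => ?_
    rw [Matrix.add_mulVec, ← Matrix.mulVec_mulVec, Matrix.sum_mulVec, Matrix.one_mulVec]
    generalize (Pi.single j 1 : ExtIdx n → ℝ) = v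
    simp only [Poisson0, Omega0, liftTensor_mulVec, poisson0_mulVec, omega0_mulVec,
      differential_cCoord, Y0, Matrix.vecMulVec_mulVec, single_one_dotProduct]
    ext ((i | i) | i) <;> simp [base, Pi.single_apply, Finset.sum_apply]
  unity_cotangent w _ := by
    refine Matrix.ext_of_mulVec_single fun j => ?_
    rw [Matrix.add_mulVec, ← Matrix.mulVec_mulVec, Matrix.sum_mulVec, Matrix.one_mulVec]
    generalize (Pi.single j 1 : ExtIdx n → ℝ) = v
    simp only [Poisson0, Omega0, liftTensor_mulVec, poisson0_mulVec, omega0_mulVec,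
      differential_cCoord, Y0, Matrix.vecMulVec_mulVec, single_one_dotProduct]
    ext ((i | i) | i) <;> simp [base, Pi.single_apply, Finset.sum_apply]

end StackelLift

/-! ### Stäckel systems: solvability, smoothness, differentials of the Hamiltonians, recursion -/

namespace StackelData

variable {r : ℕ} {n : Fin r → ℕ} (S : StackelData n)

theorem contDiff_pair (j : Fin (StackelDof n)) :
    ContDiff ℝ ∞ (fun z : PhaseIdx n → ℝ => pair z j) :=
  (contDiff_apply ℝ ℝ _).prodMk (contDiff_apply ℝ ℝ _)

/-- This is where separation of variables enters the differential calculus. -/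
theorem differential_comp_pair {f : ℝ × ℝ → ℝ} {z : PhaseIdx n → ℝ} {j : Fin (StackelDof n)}
    {p : PhaseIdx n} (hf : DifferentiableAt ℝ f (pair z j)) (hl : p ≠ Sum.inl j)
    (hr : p ≠ Sum.inr j) : differential (fun y => f (pair y j)) z p = 0 := by
  have hp : HasFDerivAt (fun y : PhaseIdx n → ℝ => pair y j)
      ((ContinuousLinearMap.proj (R := ℝ) (φ := fun _ : PhaseIdx n => ℝ) (Sum.inl j)).prod
        (ContinuousLinearMap.proj (R := ℝ) (φ := fun _ : PhaseIdx n => ℝ) (Sum.inr j))) z :=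
    (ContinuousLinearMap.proj (R := ℝ) (φ := fun _ : PhaseIdx n => ℝ) (Sum.inl j)).hasFDerivAt.prodMk
      (ContinuousLinearMap.proj (R := ℝ) (φ := fun _ : PhaseIdx n => ℝ) (Sum.inr j)).hasFDerivAt
  have h : HasFDerivAt (fun y => f (pair y j)) _ z := hf.hasFDerivAt.comp z hp
  rw [differential, h.fderiv]
  simp only [ContinuousLinearMap.comp_apply, ContinuousLinearMap.prod_apply,
    ContinuousLinearMap.proj_apply, Pi.single_eq_of_ne hl.symm, Pi.single_eq_of_ne hr.symm]
  exact map_zero (fderiv ℝ f (pair z j))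

/-- The Stäckel matrix entry `(j, m)` as a function of `(λ^j, μ_j)`. -/
noncomputable def entry (j m : Fin (StackelDof n)) (q : ℝ × ℝ) : ℝ :=
  S.φ j (finSigmaFinEquiv.symm m).1 q *
    q.1 ^ (n (finSigmaFinEquiv.symm m).1 - ((finSigmaFinEquiv.symm m).2.val + 1))

theorem matrix_apply_finSigmaFinEquiv (z : PhaseIdx n → ℝ) (j : Fin (StackelDof n)) (k : Fin r)
    (i : Fin (n k)) : S.matrix z j (finSigmaFinEquiv ⟨k, i⟩) =
      S.φ j k (pair z j) * z (Sum.inl j) ^ (n k - (i.val + 1)) := by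
  unfold matrix
  rw [Equiv.symm_apply_apply]

theorem solves_iff_mulVec (z : PhaseIdx n → ℝ) (a : (k : Fin r) → Fin (n k) → ℝ)
    (b : Fin (StackelDof n) → ℝ) :
    S.Solves z a b ↔
      S.matrix z *ᵥ (fun m => a (finSigmaFinEquiv.symm m).1 (finSigmaFinEquiv.symm m).2) = b := by
  rw [funext_iff]
  refine forall_congr' fun j => ?_
  rw [Matrix.mulVec, dotProduct, ← finSigmaFinEquiv.sum_comp, Fintype.sum_sigma]
  have h : ∀ k i, a (finSigmaFinEquiv.symm (finSigmaFinEquiv ⟨k, i⟩)).1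
      (finSigmaFinEquiv.symm (finSigmaFinEquiv ⟨k, i⟩)).2 = a k i := by
    intro k i
    rw [Equiv.symm_apply_apply]
  simp only [matrix_apply_finSigmaFinEquiv, chainPoly, Finset.mul_sum, mul_assoc, h]

theorem solves_iff_of_det_ne_zero {z : PhaseIdx n → ℝ} (hz : (S.matrix z).det ≠ 0)
    (a : (k : Fin r) → Fin (n k) → ℝ) (b : Fin (StackelDof n) → ℝ) :
    S.Solves z a b ↔ a = fun k i => ((S.matrix z)⁻¹ *ᵥ b) (finSigmaFinEquiv ⟨k, i⟩) := by
  have hu : IsUnit (S.matrix z).det := isUnit_iff_ne_zero.2 hz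
  rw [solves_iff_mulVec]
  constructor
  · rintro rfl
    rw [Matrix.mulVec_mulVec, Matrix.nonsing_inv_mul _ hu, Matrix.one_mulVec]
    ext k i
    rw [Equiv.symm_apply_apply]
  · rintro rfl
    simp only [Sigma.eta, Equiv.apply_symm_apply]
    rw [Matrix.mulVec_mulVec, Matrix.mul_nonsing_inv _ hu, Matrix.one_mulVec]

variable {S} {U : Set (PhaseIdx n → ℝ)}

theorem IsSystemOn.contDiffAt_entry (hS : S.IsSystemOn U) (j m : Fin (StackelDof n))
    {z : PhaseIdx n → ℝ} (hz : z ∈ U) : ContDiffAt ℝ ∞ (S.entry j m) (pair z j) :=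
  (hS.smooth_φ j _ z hz).mul (contDiff_fst.pow _).contDiffAt

theorem IsSystemOn.contDiffAt_matrix (hS : S.IsSystemOn U) (j m : Fin (StackelDof n))
    {z : PhaseIdx n → ℝ} (hz : z ∈ U) : ContDiffAt ℝ ∞ (fun y => S.matrix y j m) z :=
  ContDiffAt.comp (g := S.entry j m) z (hS.contDiffAt_entry j m hz)
    (contDiff_pair j).contDiffAt

theorem IsSystemOn.contDiffAt_rhsH (hS : S.IsSystemOn U) (j : Fin (StackelDof n))
    {z : PhaseIdx n → ℝ} (hz : z ∈ U) : ContDiffAt ℝ ∞ (fun y => S.rhsH y j) z :=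
  (hS.smooth_ψ j z hz).comp z (contDiff_pair j).contDiffAt

theorem IsSystemOn.contDiffAt_rhsF (hS : S.IsSystemOn U) (l : Fin r) (j : Fin (StackelDof n))
    {z : PhaseIdx n → ℝ} (hz : z ∈ U) : ContDiffAt ℝ ∞ (fun y => S.rhsF l y j) z :=
  ((hS.smooth_φ j l z hz).comp z (contDiff_pair j).contDiffAt).mul
    ((contDiff_apply ℝ ℝ _).pow _).contDiffAt

theorem _root_.ContDiffAt.matrix_det {E ι : Type*} [NormedAddCommGroup E] [NormedSpace ℝ E]
    [Fintype ι] [DecidableEq ι] {A : E → Matrix ι ι ℝ} {z : E}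
    (hA : ∀ i j, ContDiffAt ℝ ∞ (fun y => A y i j) z) : ContDiffAt ℝ ∞ (fun y => (A y).det) z := by
  simp only [Matrix.det_apply]
  exact ContDiffAt.sum fun σ _ => (contDiffAt_prod fun i _ => hA _ _).const_smul _

/-- By Cramer's rule, the solution of the Stäckel system depends smoothly on the point. -/
theorem IsSystemOn.contDiffAt_solution (hS : S.IsSystemOn U)
    {b : (PhaseIdx n → ℝ) → Fin (StackelDof n) → ℝ} {z : PhaseIdx n → ℝ} (hz : z ∈ U)
    (hb : ∀ j, ContDiffAt ℝ ∞ (fun y => b y j) z) (m : Fin (StackelDof n)) :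
    ContDiffAt ℝ ∞ (fun y => ((S.matrix y)⁻¹ *ᵥ b y) m) z := by
  have h : ContDiffAt ℝ ∞
      (fun y => (S.matrix y).det⁻¹ * ((S.matrix y).updateCol m (b y)).det) z := by
    refine ((ContDiffAt.matrix_det fun i j => hS.contDiffAt_matrix i j hz).inv
      (hS.det_ne_zero z hz)).mul (ContDiffAt.matrix_det fun i j => ?_)
    simp only [Matrix.updateCol_apply]
    split_ifs
    · exact hb i
    · exact hS.contDiffAt_matrix i j hz
  -- Cramer's formula is applied at nearby points too; they lie in the open set `U`, where the
  -- determinant is nonzero.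
  refine h.congr_of_eventuallyEq ?_
  filter_upwards [hS.isOpen.mem_nhds hz] with y hy
  have hd := hS.det_ne_zero y hy
  have := congrFun (Matrix.det_smul_inv_mulVec_eq_cramer (S.matrix y) (b y)
    (isUnit_iff_ne_zero.2 hd)) m
  rw [Matrix.cramer_apply] at this
  rw [← this, Pi.smul_apply, smul_eq_mul, inv_mul_cancel_left₀ hd]

theorem IsSystemOn.contDiffAt_h (hS : S.IsSystemOn U) (k : Fin r) (i : Fin (n k))
    {z : PhaseIdx n → ℝ} (hz : z ∈ U) : ContDiffAt ℝ ∞ (S.h k i) z :=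
  hS.contDiffAt_solution hz (fun j => hS.contDiffAt_rhsH j hz) _

theorem IsSystemOn.contDiffOn_h (hS : S.IsSystemOn U) (k : Fin r) (i : Fin (n k)) :
    ContDiffOn ℝ ∞ (S.h k i) U :=
  fun _ hz => (hS.contDiffAt_h k i hz).contDiffWithinAt

theorem IsSystemOn.contDiffOn_F (hS : S.IsSystemOn U) (k l : Fin r) (i : Fin (n k)) :
    ContDiffOn ℝ ∞ (S.F k l i) U := fun _ hz =>
  (hS.contDiffAt_solution hz (fun j => hS.contDiffAt_rhsF l j hz) _).contDiffWithinAt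

/-- Both partial derivatives of the Hamiltonians with respect to `λ^j` and `μ_j` are proportional,
with factors independent of the Hamiltonian, to the `j`-th column of the inverse Stäckel matrix. -/
theorem IsSystemOn.exists_differential_h (hS : S.IsSystemOn U) {z : PhaseIdx n → ℝ} (hz : z ∈ U) :
    ∃ u v : Fin (StackelDof n) → ℝ, ∀ (k : Fin r) (i : Fin (n k)), differential (S.h k i) z =
      Sum.elim (fun j => (S.matrix z)⁻¹ (finSigmaFinEquiv ⟨k, i⟩) j * u j)
        (fun j => (S.matrix z)⁻¹ (finSigmaFinEquiv ⟨k, i⟩) j * v j) := by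
  set H : Fin (StackelDof n) → (PhaseIdx n → ℝ) → ℝ :=
    fun m y => ((S.matrix y)⁻¹ *ᵥ S.rhsH y) m
  -- What remains of the differentiated `j`-th relation once the derivatives of the matrix entries
  -- are moved to the right-hand side.
  set g : Fin (StackelDof n) → PhaseIdx n → ℝ := fun j => differential (fun y => S.rhsH y j) z -
    ∑ m, H m z • differential (fun y => S.matrix y j m) z with hg
  have hHd : ∀ m, DifferentiableAt ℝ (H m) z := fun m =>
    (hS.contDiffAt_solution hz (fun j => hS.contDiffAt_rhsH j hz) m).differentiableAt (by simp)
  have hAd : ∀ j m, DifferentiableAt ℝ (fun y => S.matrix y j m) z := fun j m =>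
    (hS.contDiffAt_matrix j m hz).differentiableAt (by simp)
  have hrel : ∀ j, ∑ m, S.matrix z j m • differential (H m) z = g j := by
    intro j
    have h1 : (fun y => ∑ m, S.matrix y j m * H m y) =ᶠ[nhds z] fun y => S.rhsH y j := by
      filter_upwards [hS.isOpen.mem_nhds hz] with y hy
      change (S.matrix y *ᵥ ((S.matrix y)⁻¹ *ᵥ S.rhsH y)) j = _
      rw [Matrix.mulVec_mulVec,
        Matrix.mul_nonsing_inv _ (isUnit_iff_ne_zero.2 (hS.det_ne_zero y hy)), Matrix.one_mulVec]
    have h2 := differential_congr h1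
    rw [differential_sum _ fun m _ => (hAd j m).fun_mul (hHd m)] at h2
    simp only [differential_mul (hAd j _) (hHd _), Finset.sum_add_distrib] at h2
    exact eq_sub_of_add_eq h2
  have hloc : ∀ j p, p ≠ Sum.inl j → p ≠ Sum.inr j → g j p = 0 := by
    intro j p hl hr
    have h1 : differential (fun y => S.rhsH y j) z p = 0 :=
      differential_comp_pair ((hS.smooth_ψ j z hz).differentiableAt (by simp)) hl hr
    have h2 : ∀ m, differential (fun y => S.matrix y j m) z p = 0 := fun m =>
      differential_comp_pair ((hS.contDiffAt_entry j m hz).differentiableAt (by simp)) hl hr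
    simp [hg, h1, h2]
  have hsol : ∀ m p, differential (H m) z p = ∑ j, (S.matrix z)⁻¹ m j * g j p := by
    intro m p
    have h1 : S.matrix z *ᵥ (fun m => differential (H m) z p) = fun j => g j p := by
      ext j
      rw [← hrel j]
      simp [Matrix.mulVec, dotProduct]
    change _ = ((S.matrix z)⁻¹ *ᵥ fun j => g j p) m
    rw [← h1, Matrix.mulVec_mulVec,
      Matrix.nonsing_inv_mul _ (isUnit_iff_ne_zero.2 (hS.det_ne_zero z hz)), Matrix.one_mulVec]
  refine ⟨fun j => g j (Sum.inl j), fun j => g j (Sum.inr j), fun k i => ?_⟩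
  ext (j | j)
  all_goals
    change differential (H (finSigmaFinEquiv ⟨k, i⟩)) z _ = _
    rw [hsol, Finset.sum_eq_single j]
    · rfl
    · intro j' _ hj
      rw [hloc j' _ (by simp [hj.symm]) (by simp [hj.symm]), mul_zero]
    · simp

/-- The recursion satisfied by the rows of the inverse Stäckel matrix. -/
theorem inv_matrix_recursion (hn : ∀ k, 0 < n k) {z : PhaseIdx n → ℝ} (hz : (S.matrix z).det ≠ 0)
    (k : Fin r) (i : Fin (n k)) (j : Fin (StackelDof n)) :
    z (Sum.inl j) * (S.matrix z)⁻¹ (finSigmaFinEquiv ⟨k, i⟩) j =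
      (if h : i.val + 1 < n k then (S.matrix z)⁻¹ (finSigmaFinEquiv ⟨k, ⟨i.val + 1, h⟩⟩) j else 0) +
        ∑ l, S.F k l i z * (S.matrix z)⁻¹ (finSigmaFinEquiv ⟨l, ⟨0, hn l⟩⟩) j := by
  have hu : IsUnit (S.matrix z).det := isUnit_iff_ne_zero.2 hz
  set A := S.matrix z with hA
  have hBA : ∀ a b, ∑ j, A⁻¹ (finSigmaFinEquiv a) j * A j (finSigmaFinEquiv b) =
      if a = b then 1 else 0 := by
    intro a b
    rw [← Matrix.mul_apply, Matrix.nonsing_inv_mul _ hu, Matrix.one_apply]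
    simp
  -- Since `A` is invertible, the two row vectors may be compared after multiplication by `A`, where
  -- products of rows of `A⁻¹` with columns of `A` become Kronecker deltas.
  suffices h : (fun j => z (Sum.inl j) * A⁻¹ (finSigmaFinEquiv ⟨k, i⟩) j) ᵥ* A =
      (fun j => (if h : i.val + 1 < n k then A⁻¹ (finSigmaFinEquiv ⟨k, ⟨i.val + 1, h⟩⟩) j else 0) +
        ∑ l, S.F k l i z * A⁻¹ (finSigmaFinEquiv ⟨l, ⟨0, hn l⟩⟩) j) ᵥ* A by
    have := congrArg (· ᵥ* A⁻¹) h
    simp only [Matrix.vecMul_vecMul, Matrix.mul_nonsing_inv _ hu, Matrix.vecMul_one] at this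
    exact congrFun this j
  ext m
  obtain ⟨⟨l, i'⟩, rfl⟩ := finSigmaFinEquiv.surjective m
  have hR : ((fun j => (if h : i.val + 1 < n k then
        A⁻¹ (finSigmaFinEquiv ⟨k, ⟨i.val + 1, h⟩⟩) j else 0) +
      ∑ l, S.F k l i z * A⁻¹ (finSigmaFinEquiv ⟨l, ⟨0, hn l⟩⟩) j) ᵥ* A) (finSigmaFinEquiv ⟨l, i'⟩) =
      (if h : i.val + 1 < n k then
        (if (⟨k, ⟨i.val + 1, h⟩⟩ : (k : Fin r) × Fin (n k)) = ⟨l, i'⟩ then 1 else 0) else 0) +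
      ∑ l', S.F k l' i z *
        (if (⟨l', ⟨0, hn l'⟩⟩ : (k : Fin r) × Fin (n k)) = ⟨l, i'⟩ then 1 else 0) := by
    simp only [Matrix.vecMul, dotProduct, add_mul, Finset.sum_add_distrib, Finset.sum_mul]
    congr 1
    · by_cases h : i.val + 1 < n k
      · simp only [dif_pos h]
        exact hBA _ _
      · simp [dif_neg h]
    · rw [Finset.sum_comm]
      refine Finset.sum_congr rfl fun l' _ => ?_
      rw [← hBA, Finset.mul_sum]
      exact Finset.sum_congr rfl fun j _ => by ring
  rw [hR]
  obtain ⟨i', hi'⟩ := i'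
  rcases i' with _ | i'
  · have h1 : ∀ j, z (Sum.inl j) * A⁻¹ (finSigmaFinEquiv ⟨k, i⟩) j *
        A j (finSigmaFinEquiv ⟨l, ⟨0, hi'⟩⟩) = A⁻¹ (finSigmaFinEquiv ⟨k, i⟩) j * S.rhsF l z j := by
      intro j
      rw [hA, matrix_apply_finSigmaFinEquiv, rhsF]
      obtain ⟨d, hd⟩ := Nat.exists_eq_add_of_lt hi'
      simp only [hd, zero_add, Nat.add_sub_cancel, pow_succ]
      ring
    have h2 : ∀ l', ((⟨l', ⟨0, hn l'⟩⟩ : (k : Fin r) × Fin (n k)) = ⟨l, ⟨0, hi'⟩⟩) ↔ l' = l := by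
      intro l'
      constructor
      · intro h
        exact congrArg Sigma.fst h
      · rintro rfl
        rfl
    have h3 : ∀ h, (⟨k, ⟨i.val + 1, h⟩⟩ : (k : Fin r) × Fin (n k)) ≠ ⟨l, ⟨0, hi'⟩⟩ := by
      intro h heq
      have := congrArg (fun s : (k : Fin r) × Fin (n k) => s.2.val) heq
      simp at this
    simp only [h2, h3, Matrix.vecMul, dotProduct, h1]
    simp only [if_false, dite_eq_ite, ite_self, zero_add, mul_ite, mul_one, mul_zero,
      Finset.sum_ite_eq', Finset.mem_univ, if_true]
    rfl
  -- In any other column the extra factor `λ^j` lowers the index by one, which stays in the same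
  -- block.
  · have h1 : ∀ j, z (Sum.inl j) * A⁻¹ (finSigmaFinEquiv ⟨k, i⟩) j *
        A j (finSigmaFinEquiv ⟨l, ⟨i' + 1, hi'⟩⟩) = A⁻¹ (finSigmaFinEquiv ⟨k, i⟩) j *
          A j (finSigmaFinEquiv ⟨l, ⟨i', by omega⟩⟩) := by
      intro j
      rw [hA, matrix_apply_finSigmaFinEquiv, matrix_apply_finSigmaFinEquiv]
      obtain ⟨d, hd⟩ := Nat.exists_eq_add_of_lt hi'
      have e1 : n l - (i' + 1 + 1) = d := by omega
      have e2 : n l - (i' + 1) = d + 1 := by omega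
      simp only [e1, e2, pow_succ]
      ring
    have h2 : ∀ l', (⟨l', ⟨0, hn l'⟩⟩ : (k : Fin r) × Fin (n k)) ≠ ⟨l, ⟨i' + 1, hi'⟩⟩ := by
      intro l' heq
      have := congrArg (fun s : (k : Fin r) × Fin (n k) => s.2.val) heq
      simp at this
    simp only [h2, Matrix.vecMul, dotProduct, h1, hBA]
    simp only [if_false, mul_zero, Finset.sum_const_zero, add_zero]
    obtain ⟨i, hi⟩ := i
    by_cases hkl : k = l
    · subst hkl
      by_cases hii : i = i'
      · subst hii
        simp [hi']
      · simp [hii]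
    · simp [hkl]

end StackelData

/-! ### The bi-inverse-Hamiltonian chains -/

namespace StackelLift

variable {r : ℕ} {n : Fin r → ℕ} {S : StackelData n} {U : Set (PhaseIdx n → ℝ)}

theorem Y_succ (k : Fin r) (i : Fin (n k)) (w : ExtIdx n → ℝ) :
    Y S k i.succ w = Sum.elim (poisson0 n (base w) *ᵥ differential (S.h k i) (base w))
      (fun l => -S.F k l i (base w)) := by
  change X S k i w - ∑ l, liftFun (S.F k l i) w • Y0 n l w = _
  ext (j | l) <;> simp [X, liftVec, liftFun, Y0, Finset.sum_apply, Pi.single_apply]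

theorem contDiffOn_Y (hS : S.IsSystemOn U) (k : Fin r) (i : Fin (n k + 1)) :
    ContDiffOn ℝ ∞ (Y S k i) (domain U) := by
  refine Fin.cases ?_ (fun i => ?_) i
  · exact contDiffOn_const
  · refine contDiffOn_pi.2 fun p => ?_
    simp only [Y_succ, poisson0_mulVec]
    have hd : ∀ p, ContDiffOn ℝ ∞ (fun w => differential (S.h k i) (base w) p) (domain U) :=
      fun p => contDiffOn_liftFun (contDiffOn_differential hS.isOpen (hS.contDiffOn_h k i) p)
    rcases p with (p | p) | l
    · exact hd _
    · exact (hd _).neg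
    · exact (contDiffOn_liftFun (hS.contDiffOn_F k l i)).neg

theorem Omega0_mulVec_Y_zero (k : Fin r) (w : ExtIdx n → ℝ) : Omega0 n w *ᵥ Y S k 0 w = 0 := by
  change Omega0 n w *ᵥ Y0 n k w = 0
  rw [Omega0, liftTensor_mulVec, omega0_mulVec]
  ext ((i | i) | i) <;> simp [base, Y0]

theorem differential_liftFun_h (hS : S.IsSystemOn U) {w : ExtIdx n → ℝ} (hw : w ∈ domain U)
    (k : Fin r) (i : Fin (n k)) : differential (liftFun (S.h k i)) w =
      Sum.elim (differential (S.h k i) (base w)) 0 :=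
  differential_liftFun ((hS.contDiffAt_h k i hw).differentiableAt (by simp))

theorem Omega0_mulVec_Y_succ (hS : S.IsSystemOn U) {w : ExtIdx n → ℝ} (hw : w ∈ domain U)
    (k : Fin r) (i : Fin (n k)) :
    Omega0 n w *ᵥ Y S k i.succ w = differential (liftFun (S.h k i)) w := by
  rw [differential_liftFun_h hS hw, Y_succ, Omega0, liftTensor_mulVec, omega0_mulVec,
    poisson0_mulVec]
  ext ((i | i) | i) <;> simp [base]

theorem Omega1_mulVec (hS : S.IsSystemOn U) (hn : ∀ k, 0 < n k) {w : ExtIdx n → ℝ}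
    (hw : w ∈ domain U) (v : ExtIdx n → ℝ) :
    Omega1 S hn w *ᵥ v = Sum.elim (omega1 n (base w) *ᵥ base v +
        ∑ l, v (Sum.inr l) • differential (S.h l ⟨0, hn l⟩) (base w))
      (fun l => -(differential (S.h l ⟨0, hn l⟩) (base w) ⬝ᵥ base v)) := by
  rw [Omega1, Matrix.add_mulVec, Matrix.sum_mulVec, Omega1D, liftTensor_mulVec]
  simp only [wedge_mulVec, differential_cCoord, single_one_dotProduct,
    differential_liftFun_h hS hw]
  ext (p | l)
  · simp [Finset.sum_apply]
  · simp [Finset.sum_apply, Pi.single_apply, dotProduct, Fintype.sum_sum_type, base]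

theorem Omega1_mulVec_Y_zero (hS : S.IsSystemOn U) (hn : ∀ k, 0 < n k) {w : ExtIdx n → ℝ}
    (hw : w ∈ domain U) (k : Fin r) :
    Omega1 S hn w *ᵥ Y S k 0 w = differential (liftFun (S.h k ⟨0, hn k⟩)) w := by
  change Omega1 S hn w *ᵥ Y0 n k w = _
  have hb : base (Y0 n k w) = 0 := by
    ext
    simp [base, Y0]
  rw [Omega1_mulVec hS hn hw, differential_liftFun_h hS hw, hb]
  ext (p | l) <;> simp [Y0, Pi.single_apply]

/-- The Stäckel Hamiltonians are in involution with respect to `π_0`. -/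
theorem differential_h_dotProduct_poisson0_mulVec (hS : S.IsSystemOn U) {z : PhaseIdx n → ℝ}
    (hz : z ∈ U) (k l : Fin r) (i : Fin (n k)) (i' : Fin (n l)) :
    differential (S.h l i') z ⬝ᵥ (poisson0 n z *ᵥ differential (S.h k i) z) = 0 := by
  obtain ⟨u, v, h⟩ := hS.exists_differential_h hz
  rw [h, h, poisson0_mulVec, dotProduct, Fintype.sum_sum_type, ← Finset.sum_add_distrib]
  refine Finset.sum_eq_zero fun j _ => ?_
  simp only [Sum.elim_inl, Sum.elim_inr]
  ring

/-- The recursion for rows of the inverse matrix, transported to differentials: the `c` components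
of `Y_i` subtract exactly its `F` terms. The value `0` past the end of the block is what terminates
the chain. -/
theorem Omega1_mulVec_Y_succ (hS : S.IsSystemOn U) (hn : ∀ k, 0 < n k) {w : ExtIdx n → ℝ}
    (hw : w ∈ domain U) (k : Fin r) (i : Fin (n k)) :
    Omega1 S hn w *ᵥ Y S k i.succ w =
      if h : i.val + 1 < n k then differential (liftFun (S.h k ⟨i.val + 1, h⟩)) w else 0 := by
  have hb : base (Y S k i.succ w) = poisson0 n (base w) *ᵥ differential (S.h k i) (base w) := by
    rw [Y_succ]
    rfl
  rw [Omega1_mulVec hS hn hw, hb]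
  -- Involution disposes of the `c` components.
  simp only [differential_h_dotProduct_poisson0_mulVec hS hw, neg_zero, Y_succ, Sum.elim_inr]
  obtain ⟨u, v, h⟩ := hS.exists_differential_h hw
  simp only [differential_liftFun_h hS hw, h, omega1_mulVec, poisson0_mulVec]
  have hrec := StackelData.inv_matrix_recursion (S := S) hn (hS.det_ne_zero _ hw) k i
  -- The factor `t` stands for `u j` in the `λ^j` component and for `v j` in the `μ_j` component.
  have key : ∀ (j : Fin (StackelDof n)) (t : ℝ),
      base w (Sum.inl j) * ((S.matrix (base w))⁻¹ (finSigmaFinEquiv ⟨k, i⟩) j * t) -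
        ∑ l, S.F k l i (base w) *
          ((S.matrix (base w))⁻¹ (finSigmaFinEquiv ⟨l, ⟨0, hn l⟩⟩) j * t) =
      if h : i.val + 1 < n k then
        (S.matrix (base w))⁻¹ (finSigmaFinEquiv ⟨k, ⟨i.val + 1, h⟩⟩) j * t else 0 := by
    intro j t
    simp only [← mul_assoc]
    rw [hrec, add_mul, Finset.sum_mul, add_sub_cancel_right]
    split_ifs <;> simp
  ext ((j | j) | l)
  · have := key j (u j)
    split_ifs at this ⊢ <;> simpa [Finset.sum_apply, sub_eq_add_neg] using this
  · have := key j (v j)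
    split_ifs at this ⊢ <;> simpa [Finset.sum_apply, sub_eq_add_neg] using this
  · split_ifs <;> simp

theorem Omega1_mulVec_Y_castSucc (hS : S.IsSystemOn U) (hn : ∀ k, 0 < n k) {w : ExtIdx n → ℝ}
    (hw : w ∈ domain U) (k : Fin r) (i : Fin (n k)) :
    Omega1 S hn w *ᵥ Y S k i.castSucc w = differential (liftFun (S.h k i)) w := by
  obtain ⟨_ | i, hi⟩ := i
  · exact Omega1_mulVec_Y_zero hS hn hw k
  · have := Omega1_mulVec_Y_succ hS hn hw k ⟨i, by omega⟩
    rwa [dif_pos hi] at this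

theorem Omega1_mulVec_Y_last (hS : S.IsSystemOn U) (hn : ∀ k, 0 < n k) {w : ExtIdx n → ℝ}
    (hw : w ∈ domain U) (k : Fin r) : Omega1 S hn w *ᵥ Y S k (Fin.last (n k)) w = 0 := by
  have hk := hn k
  -- The last field `Y_{n_k}` is the successor of the zero-based index `n_k - 1`, which exists
  -- because `n_k > 0`.
  have := Omega1_mulVec_Y_succ hS hn hw k ⟨n k - 1, by omega⟩
  rw [dif_neg (by simp only; omega)] at this
  convert this using 3
  ext
  simp only [Fin.val_last, Fin.val_succ]
  omega

end StackelLift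

theorem mainTheorem4 {r : ℕ} (n : Fin r → ℕ) (hn : ∀ k, 0 < n k) (S : StackelData n)
    (U : Set (PhaseIdx n → ℝ)) (hS : S.IsSystemOn U) :
    -- the Hamiltonians and the expansion coefficients are smooth, and they are
    -- the unique solutions of their defining linear systems
    (∀ k i, ContDiffOn ℝ ∞ (S.h k i) U) ∧
    (∀ k l i, ContDiffOn ℝ ∞ (S.F k l i) U) ∧
    (∀ z ∈ U, ∀ a : (k : Fin r) → Fin (n k) → ℝ,
      S.Solves z a (S.rhsH z) ↔ a = fun k i => S.h k i z) ∧
    (∀ l, ∀ z ∈ U, ∀ a : (k : Fin r) → Fin (n k) → ℝ,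
      S.Solves z a (S.rhsF l z) ↔ a = fun k i => S.F k l i z) ∧
    -- the lifted dual pair, and the kernels of the lifted tensors
    Presymplectic.IsDualPairWith (StackelLift.domain U) (StackelLift.Poisson0 n)
      (StackelLift.Omega0 n) (StackelLift.cCoord n) (StackelLift.Y0 n) ∧
    (∀ w ∈ StackelLift.domain U, (∀ j, StackelLift.base w (Sum.inl j) ≠ 0) →
      Presymplectic.kernel (StackelLift.Omega1D n w) =
          Presymplectic.kernel (StackelLift.Omega0 n w) ∧
      Presymplectic.kernel (StackelLift.Poisson1D n w) =
          Presymplectic.kernel (StackelLift.Poisson0 n w)) ∧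
    -- `Ω_1` is presymplectic and the `Y_i^{(k)}` are smooth vector fields
    Presymplectic.IsPresymplecticOn (StackelLift.domain U) (StackelLift.Omega1 S hn) ∧
    (∀ k i, ContDiffOn ℝ ∞ (StackelLift.Y S k i) (StackelLift.domain U)) ∧
    -- the bi-inverse-Hamiltonian chains
    (∀ w ∈ StackelLift.domain U, ∀ k,
      StackelLift.Omega0 n w *ᵥ StackelLift.Y S k 0 w = 0 ∧
      (∀ i : Fin (n k),
        StackelLift.Omega0 n w *ᵥ StackelLift.Y S k i.succ w =
            Presymplectic.differential (StackelLift.liftFun (S.h k i)) w ∧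
        Presymplectic.differential (StackelLift.liftFun (S.h k i)) w =
            StackelLift.Omega1 S hn w *ᵥ StackelLift.Y S k i.castSucc w) ∧
      StackelLift.Omega1 S hn w *ᵥ StackelLift.Y S k (Fin.last (n k)) w = 0) ∧
    -- d-compatibility
    (∀ w ∈ StackelLift.domain U,
      StackelLift.Poisson0 n w * StackelLift.Omega1 S hn w * StackelLift.Poisson0 n w =
        StackelLift.Poisson1D n w) ∧
    Presymplectic.IsDCompatible r (StackelLift.domain U) (StackelLift.Omega0 n)
      (StackelLift.Omega1 S hn) (StackelLift.Poisson0 n) := by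
  have hD := StackelLift.isOpen_domain hS.isOpen
  have hO1 := StackelLift.isPresymplecticOn_Omega1 S hn hS.isOpen hS.contDiffOn_h
  have hdual := StackelLift.isDualPairWith_Poisson0_Omega0 (n := n) hD
  refine ⟨hS.contDiffOn_h, hS.contDiffOn_F,
    fun z hz a => S.solves_iff_of_det_ne_zero (hS.det_ne_zero z hz) a _,
    fun l z hz a => S.solves_iff_of_det_ne_zero (hS.det_ne_zero z hz) a _, hdual,
    fun w _ hw => ⟨StackelLift.kernel_Omega1D_eq hw, StackelLift.kernel_Poisson1D_eq hw⟩, hO1,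
    StackelLift.contDiffOn_Y hS, fun w hw k => ⟨StackelLift.Omega0_mulVec_Y_zero k w,
      fun i => ⟨StackelLift.Omega0_mulVec_Y_succ hS hw k i,
        (StackelLift.Omega1_mulVec_Y_castSucc hS hn hw k i).symm⟩,
      StackelLift.Omega1_mulVec_Y_last hS hn hw k⟩,
    fun w _ => StackelLift.Poisson0_mul_Omega1_mul_Poisson0 S hn w,
    ⟨hdual.presymplectic, hO1, ⟨_, _, hdual⟩, ?_⟩⟩
  simp only [StackelLift.Poisson0_mul_Omega1_mul_Poisson0]
  exact StackelLift.isPoissonOn_Poisson1D _
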